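/- For $n\ge 1$ let $\mathcal S_n$ be the set of permutations of $\{1,\dots,n\}$, and $\mathcal S=\bigcup_{n\ge1}\mathcal S_n$. The reduction of a sequence of $n$ distinct real numbers is the permutation in $\mathcal S_n$ whose entries are in the same relative order. A permutation $\pi$ contains $\sigma\in\mathcal S_n$ as a consecutive pattern ($\sigma$ is a subpattern of $\pi$) if some $n$ consecutive entries of $\pi$ have reduction $\sigma$; otherwise $\pi$ avoids $\sigma$. For a map $f:I\to I$ on an interval $I\subseteq\mathbb R$, a permutation $\pi\in\mathcal S_n$ is allowed if it is the reduction of $x,f(x),\dots,f^{n-1}(x)$ for some $x\in I$ for which these $n$ values are distinct. A basic forbidden pattern of $f$ is a permutation in $\mathcal S$ that is not allowed, but all of whose proper subpatterns (those different from it) are allowed. The map $f$ is piecewise monotone if $I$ has a finite partition into intervals on each of which $f$ is continuous and strictly monotone. Proposition. Let $m\ge1$, let $\Sigma=\{\sigma_1,\dots,\sigma_m\}\subset\mathcal S$ be an antichain of $m$ distinct permutations with respect to consecutive pattern containment, let $k_i$ be the length of $\sigma_i$, and suppose that $k_1\le k_2\le\dots\le k_m$. Put $\ell=\lfloor k_1/2\rfloor$.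 1. If $\Sigma$ is the set of basic forbidden patterns of a piecewise monotone map on an interval $I\subseteq\mathbb R$, then $$k_1+k_2+\dots+k_m\ \ge\ \ell!+m(\ell-1).$$ 2. If $k_1+k_2+\dots+k_m<\ell!+m(\ell-1)$, then there is a permutation $\pi$ of length $\ell$ that is contained in none of $\sigma_1,\dots,\sigma_m$ and has the following property. For $r\ge0$ let $G_{r\ell}$ be the set of permutations $\tau_1\tau_2\cdots\tau_r$ of $\{1,\dots,r\ell\}$ that are concatenations of $r$ blocks of length $\ell$, each with reduction $\pi$. Then every permutation in $G_{r\ell}$ avoids all of $\sigma_1,\dots,\sigma_m$, and the size of $G_{r\ell}$ grows superexponentially: for every real $C$, $|G_{r\ell}|>C^{r\ell}$ for all sufficiently large $r$. -/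

import Mathlib

namespace ConsecPattern

/-- The set of all permutations of `{1, …, n}`, `n ≥ 1` (zero-based in Lean). -/
abbrev Pattern : Type := Σ n : ℕ+, Equiv.Perm (Fin (n : ℕ))

/-- The length of a permutation. -/
def Pattern.length (σ : Pattern) : ℕ := (σ.1 : ℕ)

/-- `σ` is the reduction of the word `x`: the entries of `x` are pairwise distinct and `σ` lists
their ranks. (Distinctness is automatic, because `σ` is injective.) -/
def IsReduction {α : Type*} [LinearOrder α] {n : ℕ} (x : Fin n → α)
    (σ : Equiv.Perm (Fin n)) : Prop :=
  ∀ i j, x i < x j ↔ σ i < σ j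

/-- The permutation `π` contains `σ` as a consecutive pattern: some block of consecutive entries
of `π` has reduction `σ`. -/
def Contains {m n : ℕ} (π : Equiv.Perm (Fin m)) (σ : Equiv.Perm (Fin n)) : Prop :=
  ∃ (i : ℕ) (h : i + n ≤ m),
    IsReduction (fun j : Fin n => π ⟨i + (j : ℕ), by have := j.2; omega⟩) σ

/-- The consecutive containment order on permutations: `σ` is a subpattern of `π`. -/
def Subpattern (σ π : Pattern) : Prop := Contains π.2 σ.2

/-- The permutations of length `n` that avoid every pattern of `S`. -/
def avoiders (S : Set Pattern) (n : ℕ) : Set (Equiv.Perm (Fin n)) :=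
  {π | ∀ σ ∈ S, ¬ Contains π σ.2}

/-- The basis of a class of permutations: the minimal permutations outside the class. -/
def basis (A : Set Pattern) : Set Pattern :=
  {π | π ∉ A ∧ ∀ σ, Subpattern σ π → σ ≠ π → σ ∈ A}

/-- The allowed patterns of a map: the reductions of its finite orbit segments
`x, f x, …, f^[n-1] x` with pairwise distinct entries. -/
def allowed {I : Set ℝ} (f : I → I) : Set Pattern :=
  {π | ∃ x : I, IsReduction (fun i : Fin (π.1 : ℕ) => f^[(i : ℕ)] x) π.2}

/-- The basic forbidden patterns of a map: the forbidden patterns all of whose proper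
subpatterns are allowed. -/
def basicForbidden {I : Set ℝ} (f : I → I) : Set Pattern := basis (allowed f)

/-- Piecewise monotone map on `I`: there is a finite partition of `I` into intervals on each of
which `f` is continuous and strictly monotone. -/
def PiecewiseMonotone {I : Set ℝ} (f : I → I) : Prop :=
  ∃ P : Set (Set I), P.Finite ∧ Setoid.IsPartition P ∧
    ∀ J ∈ P, J.OrdConnected ∧ ContinuousOn f J ∧ (StrictMonoOn f J ∨ StrictAntiOn f J)

/-- The permutations `τ₁ τ₂ … τᵣ` of length `r * l` that are concatenations of `r` blocks of
length `l`, each with reduction `π`. (`finProdFinEquiv (b, j)` is the position `b * l + j`.) -/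
def blockConcats {l : ℕ} (π : Equiv.Perm (Fin l)) (r : ℕ) : Set (Equiv.Perm (Fin (r * l))) :=
  {τ | ∀ b : Fin r, IsReduction (fun j : Fin l => τ (finProdFinEquiv (b, j))) π}

end ConsecPattern

namespace ConsecPattern

open Filter

/-! ### Reductions of words -/

section Reduction

variable {α : Type*} [LinearOrder α] {n : ℕ}

/-! Both parts rest on counting windows. There are `k i + 1 - l` windows of length `l` in `σ i`, and
the sum condition says that in total they are fewer than `l!`, so some `π` of length `l` occurs in
no `σ i` (`exists_forall_not_contains`). Since `2 * l ≤ k i`, a copy of `σ i` inside a concatenation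
of `π`-blocks would cover a whole block and thus contain `π`, so all such concatenations avoid every
`σ i` (`contains_of_mem_blockConcats`). There are at least `(r * l)! / l! ^ r` of them, which is
superexponential. If the `σ i` were the basic forbidden patterns of a piecewise monotone map, all
these concatenations would be allowed. But such a map has only exponentially many allowed patterns,
because the itinerary of an orbit segment and the comparisons with its last point determine its
reduction (`iterate_lt_iff_of_itinerary`). -/

theorem IsReduction.injective {x : Fin n → α} {σ : Equiv.Perm (Fin n)} (h : IsReduction x σ) :
    Function.Injective x := by
  intro i j hij
  apply σ.injective
  apply le_antisymm
  · exact not_lt.1 fun hlt => ((h j i).2 hlt).ne hij.symm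
  · exact not_lt.1 fun hlt => ((h i j).2 hlt).ne hij

theorem perm_eq_of_lt_iff_lt {σ τ : Equiv.Perm (Fin n)}
    (h : ∀ i j, σ i < σ j ↔ τ i < τ j) : σ = τ := by
  have hmono : StrictMono (σ.symm.trans τ) := by
    intro i j hij
    simpa using (h (σ.symm i) (σ.symm j)).1 (by simpa using hij)
  have hid : (hmono.orderIsoOfSurjective _ (σ.symm.trans τ).surjective) = OrderIso.refl _ :=
    Subsingleton.elim _ _
  ext i
  have := congrArg (fun e : Fin n ≃o Fin n => e (σ i)) hid
  simp at this
  rw [this]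

theorem IsReduction.unique {x : Fin n → α} {σ τ : Equiv.Perm (Fin n)} (hσ : IsReduction x σ)
    (hτ : IsReduction x τ) : σ = τ :=
  perm_eq_of_lt_iff_lt fun i j => (hσ i j).symm.trans (hτ i j)

theorem exists_isReduction {x : Fin n → α} (hx : Function.Injective x) :
    ∃ σ, IsReduction x σ := by
  refine ⟨(Tuple.sort x).symm, fun i j => ?_⟩
  have hs : StrictMono (x ∘ Tuple.sort x) :=
    (Tuple.monotone_sort x).strictMono_of_injective (hx.comp (Tuple.sort x).injective)
  simpa using hs.lt_iff_lt (a := (Tuple.sort x).symm i) (b := (Tuple.sort x).symm j)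

end Reduction

/-! ### Containment and window counting -/

section Containment

theorem Contains.trans {a b c : ℕ} {π : Equiv.Perm (Fin a)} {σ : Equiv.Perm (Fin b)}
    {τ : Equiv.Perm (Fin c)} (h₁ : Contains π σ) (h₂ : Contains σ τ) : Contains π τ := by
  obtain ⟨p, hp, h₁⟩ := h₁
  obtain ⟨q, hq, h₂⟩ := h₂
  refine ⟨p + q, by omega, fun i j => ?_⟩
  refine Iff.trans ?_ (h₂ i j)
  simpa [add_assoc] using h₁ ⟨q + i, by omega⟩ ⟨q + j, by omega⟩

theorem Contains.le {a b : ℕ} {π : Equiv.Perm (Fin a)} {σ : Equiv.Perm (Fin b)}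
    (h : Contains π σ) : b ≤ a := by
  obtain ⟨p, hp, -⟩ := h
  omega

theorem Subpattern.length_lt {σ π : Pattern} (h : Subpattern σ π) (hne : σ ≠ π) :
    σ.length < π.length := by
  refine lt_of_le_of_ne h.le fun heq => hne ?_
  obtain ⟨a, σ⟩ := σ
  obtain ⟨b, π⟩ := π
  obtain rfl : a = b := PNat.coe_injective heq
  obtain ⟨p, hp, h⟩ := h
  obtain rfl : p = 0 := by simpa using hp
  congr 1
  refine perm_eq_of_lt_iff_lt fun i j => ?_
  simpa using (h i j).symm

/-- A shortest counterexample would have all its proper subpatterns in `A` and so be in the basis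
itself. -/
theorem mem_of_avoids_basis {A : Set Pattern} (π : Pattern)
    (h : ∀ σ ∈ basis A, ¬ Subpattern σ π) : π ∈ A := by
  induction hn : π.length using Nat.strong_induction_on generalizing π with
  | _ n ih =>
    by_contra hπ
    refine h π ⟨hπ, fun σ hσ hne => ?_⟩ ⟨0, by simp, fun i j => by simp⟩
    exact ih _ (hn ▸ hσ.length_lt hne) σ (fun ρ hρ hρσ => h ρ hρ (Contains.trans hσ hρσ)) rfl

/-- If there are fewer windows of length `l` than permutations of length `l`, then some permutation
of length `l` occurs in none of the given permutations. -/
theorem exists_forall_not_contains {ι : Type*} [Fintype ι] {k : ι → ℕ}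
    (σ : ∀ i, Equiv.Perm (Fin (k i))) (l : ℕ) (h : ∑ i, (k i + 1 - l) < l.factorial) :
    ∃ π : Equiv.Perm (Fin l), ∀ i, ¬ Contains (σ i) π := by
  by_contra! hc
  choose i p hp hred using hc
  -- Each permutation goes to a window where it occurs; this is injective because a window has only
  -- one reduction.
  let g : Equiv.Perm (Fin l) → Σ i, Fin (k i + 1 - l) := fun π =>
    ⟨i π, p π, by have := hp π; omega⟩
  have hg : Function.Injective g := by
    intro π τ hπτ
    obtain ⟨hi, hpp⟩ := Sigma.mk.inj hπτ
    have hpp' : p π = p τ := by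
      have key : ∀ (a b : ι) (x : Fin (k a + 1 - l)) (y : Fin (k b + 1 - l)), a = b → x ≍ y →
          (x : ℕ) = y := by
        rintro a _ x y rfl hxy
        rw [eq_of_heq hxy]
      exact key _ _ _ _ hi hpp
    have h₁ := hred π
    have h₂ := hred τ
    have key : ∀ (a b : ι) (q s : ℕ) (hq : q + l ≤ k a) (hs : s + l ≤ k b), a = b → q = s →
        IsReduction (fun j : Fin l => σ a ⟨q + j, by omega⟩) π →
        IsReduction (fun j : Fin l => σ b ⟨s + j, by omega⟩) τ → π = τ := by
      rintro a _ q _ hq hs rfl rfl h₁ h₂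
      exact h₁.unique h₂
    exact key _ _ _ _ (hp π) (hp τ) hi hpp' h₁ h₂
  have := Fintype.card_le_of_injective g hg
  simp [Fintype.card_perm] at this
  omega

end Containment

/-! ### Concatenations of blocks -/

section Blocks

/-- Any `2 * l - 1` consecutive positions include a complete block. -/
theorem contains_of_mem_blockConcats {l r k : ℕ} {π : Equiv.Perm (Fin l)}
    {τ : Equiv.Perm (Fin (r * l))} {σ : Equiv.Perm (Fin k)} (hτ : τ ∈ blockConcats π r)
    (hl : 0 < l) (hk : 2 * l ≤ k + 1) (h : Contains τ σ) : Contains σ π := by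
  obtain ⟨p, hp, h⟩ := h
  obtain ⟨b, hb₁, hb₂⟩ : ∃ b, p ≤ b * l ∧ b * l < p + l := by
    -- This is `p / l` rounded up: the first block starting at or after `p`.
    refine ⟨(p + l - 1) / l, ?_, ?_⟩
    · have := Nat.lt_div_mul_add (a := p + l - 1) hl
      omega
    · have := Nat.div_mul_le_self (p + l - 1) l
      omega
  have hbr : b < r := by
    by_contra! hc
    have := Nat.mul_le_mul_right l hc
    omega
  refine ⟨b * l - p, by omega, fun i j => ?_⟩
  refine Iff.trans ?_ (hτ ⟨b, hbr⟩ i j)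
  refine (h ⟨b * l - p + i, by omega⟩ ⟨b * l - p + j, by omega⟩).symm.trans ?_
  have e : ∀ i : Fin l, (⟨p + (b * l - p + i), by omega⟩ : Fin (r * l)) =
      finProdFinEquiv (⟨b, hbr⟩, i) := by
    intro i
    ext
    simp only [finProdFinEquiv_apply_val]
    rw [mul_comm l b]
    omega
  simp only [e]

/-- Every permutation arises from a member of `blockConcats π r` by rearranging positions inside
each block. -/
theorem factorial_le_ncard_blockConcats_mul {l : ℕ} (π : Equiv.Perm (Fin l)) (r : ℕ) :
    (r * l).factorial ≤ (blockConcats π r).ncard * l.factorial ^ r := by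
  let F : blockConcats π r × (Fin r → Equiv.Perm (Fin l)) → Equiv.Perm (Fin (r * l)) :=
    fun x => (finProdFinEquiv.symm.trans
      ((Equiv.prodShear (Equiv.refl _) x.2).trans finProdFinEquiv)).trans x.1
  have hF : Function.Surjective F := by
    intro τ
    have hinj : ∀ b : Fin r, Function.Injective fun j : Fin l => τ (finProdFinEquiv (b, j)) :=
      fun b i j hij => by simpa using hij
    choose ρ hρ using fun b => exists_isReduction (hinj b)
    let s : Fin r → Equiv.Perm (Fin l) := fun b => (ρ b).trans π.symm
    refine ⟨⟨⟨(finProdFinEquiv.symm.trans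
      ((Equiv.prodShear (Equiv.refl _) fun b => (s b).symm).trans finProdFinEquiv)).trans τ,
      fun b i j => ?_⟩, s⟩, ?_⟩
    · refine Iff.trans ?_ ((hρ b ((s b).symm i) ((s b).symm j)).trans ?_)
      · simp [Equiv.prodShear]
      · simp [s]
    · ext q
      obtain ⟨p, rfl⟩ := finProdFinEquiv.surjective q
      simp only [F, Equiv.trans_apply, Equiv.symm_apply_apply]
      simp [Equiv.prodShear]
  have := Nat.card_le_card_of_surjective F hF
  rwa [Nat.card_prod, Nat.card_fun, Nat.card_perm, Nat.card_perm, Nat.card_fin, Nat.card_fin,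
    Nat.card_fin, Nat.card_coe_set_eq] at this

/-- The crude bound `r! ≤ (r * l)!` suffices, as `r!` outgrows `(|C| ^ l * l!) ^ r`. -/
theorem eventually_pow_lt_ncard_blockConcats {l : ℕ} (hl : 0 < l) (π : Equiv.Perm (Fin l))
    (C : ℝ) : ∀ᶠ r : ℕ in atTop, C ^ (r * l) < ((blockConcats π r).ncard : ℝ) := by
  have hpos : (0 : ℝ) < l.factorial := by exact_mod_cast l.factorial_pos
  have ht := FloorSemiring.tendsto_pow_div_factorial_atTop (|C| ^ l * l.factorial)
  filter_upwards [ht.eventually_lt_const one_pos] with r hr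
  rw [div_lt_one (by exact_mod_cast r.factorial_pos)] at hr
  have h₁ : ((r.factorial : ℕ) : ℝ) ≤ (blockConcats π r).ncard * (l.factorial : ℝ) ^ r := by
    exact_mod_cast (Nat.factorial_le (Nat.le_mul_of_pos_right r hl)).trans
      (factorial_le_ncard_blockConcats_mul π r)
  have h₂ := hr.trans_le h₁
  rw [mul_pow, ← pow_mul, mul_comm l r] at h₂
  have h₃ := lt_of_mul_lt_mul_right h₂ (by positivity)
  refine lt_of_le_of_lt ?_ h₃
  rw [← abs_pow]
  exact le_abs_self _

end Blocks

/-! ### Counting the allowed patterns of a piecewise monotone map -/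

section Orbits

variable {I : Set ℝ} {f : I → I}

theorem lt_iff_lt_of_mem_disjoint_ordConnected {α : Type*} [LinearOrder α] {J K : Set α}
    (hJ : J.OrdConnected) (hK : K.OrdConnected) (hd : Disjoint J K) {a b c d : α}
    (ha : a ∈ J) (hb : b ∈ J) (hc : c ∈ K) (hd' : d ∈ K) : a < c ↔ b < d := by
  have key : ∀ {a b c d : α}, a ∈ J → b ∈ J → c ∈ K → d ∈ K → a < c → b < d := by
    intro a b c d ha hb hc hd' hac
    by_contra! hdb
    rcases le_total b c with h | h
    · rcases le_total a d with h' | h'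
      · exact Set.disjoint_left.1 hd (hJ.out ha hb ⟨h', hdb⟩) hd'
      · exact Set.disjoint_left.1 hd ha (hK.out hd' hc ⟨h', hac.le⟩)
    · exact Set.disjoint_left.1 hd (hJ.out ha hb ⟨hac.le, h⟩) hc
  exact ⟨key ha hb hc hd', key hb ha hd' hc⟩

/-- An orbit segment with distinct entries is determined, up to order isomorphism, by its itinerary
and the comparison of its entries with the last one. -/
theorem iterate_lt_iff_of_itinerary {P : Set (Set I)}
    (hdisj : P.PairwiseDisjoint id)
    (hP : ∀ J ∈ P, J.OrdConnected ∧ (StrictMonoOn f J ∨ StrictAntiOn f J))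
    {N : ℕ} {x y : I} (w : ℕ → Set I) (hw : ∀ i ≤ N, w i ∈ P)
    (hx : ∀ i ≤ N, f^[i] x ∈ w i) (hy : ∀ i ≤ N, f^[i] y ∈ w i)
    (hxi : ∀ i < N, f^[i] x ≠ f^[N] x) (hyi : ∀ i < N, f^[i] y ≠ f^[N] y)
    (hlast : ∀ i < N, f^[i] x < f^[N] x ↔ f^[i] y < f^[N] y) :
    ∀ i ≤ N, ∀ j ≤ N, f^[i] x < f^[j] x ↔ f^[i] y < f^[j] y := by
  -- Downward induction on `max i j`: within one piece, monotonicity reduces a comparison to that of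
  -- the images; different pieces are ordered as a whole.
  have key : ∀ k i j, max i j + k = N → (f^[i] x < f^[j] x ↔ f^[i] y < f^[j] y) := by
    intro k
    induction k with
    | zero =>
      intro i j hij
      rcases lt_trichotomy i j with h | rfl | h
      · obtain rfl : j = N := by omega
        exact hlast i h
      · simp
      · obtain rfl : i = N := by omega
        have h₁ := hlast j h
        have h₂ := hxi j h
        have h₃ := hyi j h
        rw [← not_le, ← not_le, le_iff_lt_or_eq, le_iff_lt_or_eq]
        tauto
    | succ k ih =>
      intro i j hij
      have hi : i ≤ N := by omega
      have hj : j ≤ N := by omega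
      by_cases hwij : w i = w j
      · have e := ih (i + 1) (j + 1) (by omega)
        have e' := ih (j + 1) (i + 1) (by omega)
        simp only [Function.iterate_succ_apply'] at e e'
        rcases (hP _ (hw i hi)).2 with hm | hm
        · rwa [hm.lt_iff_lt (hx i hi) (hwij ▸ hx j hj),
            hm.lt_iff_lt (hy i hi) (hwij ▸ hy j hj)] at e
        · rwa [hm.lt_iff_gt (hwij ▸ hx j hj) (hx i hi),
            hm.lt_iff_gt (hwij ▸ hy j hj) (hy i hi)] at e'
      · exact lt_iff_lt_of_mem_disjoint_ordConnected (hP _ (hw i hi)).1 (hP _ (hw j hj)).1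
          (hdisj (hw i hi) (hw j hj) hwij) (hx i hi) (hy i hi) (hx j hj) (hy j hj)
  intro i hi j hj
  exact key (N - max i j) i j (by omega)

/-- A piecewise monotone map has at most exponentially many allowed patterns. -/
theorem PiecewiseMonotone.exists_ncard_allowed_le (hf : PiecewiseMonotone f) :
    ∃ C : ℕ, ∀ n : ℕ+,
      {π : Equiv.Perm (Fin (n : ℕ)) | (⟨n, π⟩ : Pattern) ∈ allowed f}.ncard ≤ C ^ (n : ℕ) := by
  classical
  obtain ⟨P, hfin, hpart, hP⟩ := hf
  have := hfin.to_subtype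
  have hcov : ∀ x : I, ∃ J : P, x ∈ J.1 := fun x =>
    let ⟨J, hJ, _⟩ := hpart.2 x
    ⟨⟨J, hJ.1⟩, hJ.2⟩
  choose c hc using hcov
  -- One letter per orbit point: its piece, and whether it lies below the last point.
  refine ⟨Nat.card (P × Bool), fun n => ?_⟩
  have hsel : ∀ π : {π : Equiv.Perm (Fin (n : ℕ)) | (⟨n, π⟩ : Pattern) ∈ allowed f},
      ∃ x : I, IsReduction (fun i : Fin (n : ℕ) => f^[(i : ℕ)] x) π.1 := fun π => π.2
  choose x hx using hsel
  let g : {π : Equiv.Perm (Fin (n : ℕ)) | (⟨n, π⟩ : Pattern) ∈ allowed f} →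
      (Fin (n : ℕ) → P × Bool) := fun π i =>
    (c (f^[(i : ℕ)] (x π)), decide (f^[(i : ℕ)] (x π) < f^[(n : ℕ) - 1] (x π)))
  have hn := n.pos
  have hg : Function.Injective g := by
    intro π τ h
    have h₁ : ∀ i : ℕ, i ≤ (n : ℕ) - 1 → c (f^[i] (x π)) = c (f^[i] (x τ)) := fun i hi =>
      congrArg Prod.fst (congrFun h ⟨i, by omega⟩)
    have h₂ : ∀ i : ℕ, i < (n : ℕ) - 1 →
        (f^[i] (x π) < f^[(n : ℕ) - 1] (x π) ↔ f^[i] (x τ) < f^[(n : ℕ) - 1] (x τ)) :=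
      fun i hi => by
        simpa [g] using congrArg Prod.snd (congrFun h ⟨i, by omega⟩)
    have hne : ∀ ρ, ∀ i < (n : ℕ) - 1, f^[i] (x ρ) ≠ f^[(n : ℕ) - 1] (x ρ) := by
      intro ρ i hi he
      have := (hx ρ).injective (a₁ := ⟨i, by omega⟩) (a₂ := ⟨n - 1, by omega⟩) he
      simp at this
      omega
    have key := iterate_lt_iff_of_itinerary (f := f) (P := P) hpart.pairwiseDisjoint
      (fun J hJ => ⟨(hP J hJ).1, (hP J hJ).2.2⟩) (fun i => (c (f^[i] (x π))).1)
      (fun i _ => (c _).2) (fun i _ => hc _) (fun i hi => h₁ i hi ▸ hc _) (hne π) (hne τ) h₂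
    refine Subtype.ext (perm_eq_of_lt_iff_lt fun i j => ?_)
    rw [← hx π i j, ← hx τ i j]
    exact key i (by omega) j (by omega)
  have := Nat.card_le_card_of_injective g hg
  rw [Nat.card_fun, Nat.card_fin] at this
  exact this

end Orbits

theorem exists_superexponential_blockConcats (m : ℕ) (hm : 0 < m) (σ : Fin m → Pattern)
    (hmono : Monotone fun i => (σ i).length) (l : ℕ) (hl : l = (σ ⟨0, hm⟩).length / 2)
    (h : (∑ i, ((σ i).length : ℤ)) < (l.factorial : ℤ) + (m : ℤ) * ((l : ℤ) - 1)) :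
    0 < l ∧ ∃ π : Equiv.Perm (Fin l),
      (∀ i, ¬ Contains (σ i).2 π) ∧
      (∀ r : ℕ, blockConcats π r ⊆ avoiders (Set.range σ) (r * l)) ∧
      ∀ C : ℝ, ∀ᶠ r : ℕ in atTop, C ^ (r * l) < ((blockConcats π r).ncard : ℝ) := by
  have hlen : ∀ i, 2 * l ≤ (σ i).length := fun i => by
    have : (σ ⟨0, hm⟩).length ≤ (σ i).length := hmono (Fin.mk_le_of_le_val (Nat.zero_le _))
    omega
  have hsum : ∑ i, ((σ i).length + 1 - l) < l.factorial := by
    zify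
    -- The truncated subtraction is exact because `2 * l ≤ k i`.
    have e : ∀ i, (((σ i).length + 1 - l : ℕ) : ℤ) = (σ i).length - ((l : ℤ) - 1) := fun i => by
      have := hlen i
      omega
    simp only [e, Finset.sum_sub_distrib, Finset.sum_const, Finset.card_univ, Fintype.card_fin,
      nsmul_eq_mul]
    linarith
  have hpos : 0 < l := by
    rw [Nat.pos_iff_ne_zero]
    rintro rfl
    have h₀ := Finset.single_le_sum (f := fun i => (σ i).length + 1 - 0)
      (fun i _ => Nat.zero_le _) (Finset.mem_univ (⟨0, hm⟩ : Fin m))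
    simp only [Nat.factorial_zero] at hsum
    omega
  obtain ⟨π, hπ⟩ := exists_forall_not_contains (fun i => (σ i).2) l hsum
  refine ⟨hpos, π, hπ, ?_, eventually_pow_lt_ncard_blockConcats hpos π⟩
  rintro r τ hτ _ ⟨i, rfl⟩ hc
  exact hπ i (contains_of_mem_blockConcats hτ hpos ((hlen i).trans (Nat.le_succ _)) hc)

end ConsecPattern

theorem mainTheorem7 (m : ℕ) (hm : 0 < m) (σ : Fin m → ConsecPattern.Pattern)
    (hinj : Function.Injective σ)
    (hanti : IsAntichain ConsecPattern.Subpattern (Set.range σ))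
    (hmono : Monotone fun i => (σ i).length) (l : ℕ) (hl : l = (σ ⟨0, hm⟩).length / 2) :
    (∀ (I : Set ℝ), I.OrdConnected → ∀ f : I → I, ConsecPattern.PiecewiseMonotone f →
        ConsecPattern.basicForbidden f = Set.range σ →
        (∑ i, ((σ i).length : ℤ)) ≥ (l.factorial : ℤ) + (m : ℤ) * ((l : ℤ) - 1)) ∧
    ((∑ i, ((σ i).length : ℤ)) < (l.factorial : ℤ) + (m : ℤ) * ((l : ℤ) - 1) →
      ∃ π : Equiv.Perm (Fin l),
        (∀ i, ¬ ConsecPattern.Contains (σ i).2 π) ∧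
        (∀ r : ℕ, ConsecPattern.blockConcats π r ⊆
          ConsecPattern.avoiders (Set.range σ) (r * l)) ∧
        ∀ C : ℝ, ∀ᶠ r : ℕ in Filter.atTop,
          C ^ (r * l) < ((ConsecPattern.blockConcats π r).ncard : ℝ)) := by
  have part2 := ConsecPattern.exists_superexponential_blockConcats m hm σ hmono l hl
  refine ⟨fun I _ f hf hbasis => ?_, fun h => (part2 h).2⟩
  by_contra! hlt
  obtain ⟨hpos, π, -, hav, hgrow⟩ := part2 hlt
  obtain ⟨C, hC⟩ := hf.exists_ncard_allowed_le
  obtain ⟨r, hr, hr0⟩ := ((hgrow C).and (Filter.eventually_gt_atTop 0)).exists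
  have hsub : ConsecPattern.blockConcats π r ⊆ {τ : Equiv.Perm (Fin (r * l)) |
      (⟨⟨r * l, Nat.mul_pos hr0 hpos⟩, τ⟩ : ConsecPattern.Pattern) ∈
        ConsecPattern.allowed f} := by
    intro τ hτ
    refine ConsecPattern.mem_of_avoids_basis _ fun ρ hρ hc => ?_
    exact hav r hτ ρ (hbasis ▸ hρ) hc
  have h₁ := Set.ncard_le_ncard hsub (Set.toFinite _)
  have h₂ := h₁.trans (hC ⟨r * l, Nat.mul_pos hr0 hpos⟩)
  exact absurd hr (not_lt.2 (by exact_mod_cast h₂))
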